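/- Let $d \ge 0$, $n \ge 2$, and let $S = \mathrm{Conv}(\{v_0,\dots,v_n\}) \subseteq \mathbb{R}^d$ be an $n$-dimensional simplex, i.e. $v_0,\dots,v_n \in \mathbb{R}^d$ are affinely independent. Suppose that the minimal enclosing ball of $S$, that is, the closed Euclidean ball of smallest radius containing $S$, has radius exactly $1$. Let $G_d[S]$ be the graph whose vertices are the points of $S$ and in which $x, y \in S$ are adjacent if and only if their Euclidean distance is $1$. Then $G_d[S]$ is connected: any two points of $S$ are joined by a finite path all of whose vertices lie in $S$ and all of whose steps have length exactly $1$. -/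

import Mathlib

/-- The unit distance graph of `ℝ^d`: the vertices are all points of `ℝ^d`, and two points are
adjacent iff their Euclidean distance is `1`. -/
def unitDistanceGraph (d : ℕ) : SimpleGraph (EuclideanSpace ℝ (Fin d)) where
  Adj x y := dist x y = 1
  symm := ⟨fun x y h => by rw [dist_comm]; exact h⟩
  loopless := ⟨fun x h => by simp at h⟩

/-- The radii of the enclosing balls of `X`, i.e. of the closed balls of `ℝ^d` containing `X`. -/
def enclosingRadii {d : ℕ} (X : Set (EuclideanSpace ℝ (Fin d))) : Set ℝ :=
  {r | 0 ≤ r ∧ ∃ C, X ⊆ Metric.closedBall C r}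

/-- The radius `r(X)` of a bounded set `X`: the smallest radius of an enclosing ball of `X`, i.e. the
radius of its minimal enclosing ball. The infimum is attained (`isLeast_enclosingRadius`). -/
noncomputable def enclosingRadius {d : ℕ} (X : Set (EuclideanSpace ℝ (Fin d))) : ℝ :=
  sInf (enclosingRadii X)

/-- Every bounded set has an enclosing ball of minimal radius, and that radius is
`enclosingRadius X`. -/
theorem isLeast_enclosingRadius {d : ℕ} {X : Set (EuclideanSpace ℝ (Fin d))}
    (hX : Bornology.IsBounded X) : IsLeast (enclosingRadii X) (enclosingRadius X) := by
  have hbdd : BddBelow (enclosingRadii X) := ⟨0, fun r hr => hr.1⟩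
  have hne : (enclosingRadii X).Nonempty := by
    obtain ⟨r, hr⟩ := hX.subset_closedBall 0
    exact ⟨max r 0, le_max_right _ _, 0,
      hr.trans (Metric.closedBall_subset_closedBall (le_max_left _ _))⟩
  have h0 : 0 ≤ enclosingRadius X := le_csInf hne fun r hr => hr.1
  refine ⟨⟨h0, ?_⟩, fun r hr => csInf_le hbdd hr⟩
  rcases X.eq_empty_or_nonempty with rfl | ⟨x₀, hx₀⟩
  · exact ⟨0, Set.empty_subset _⟩
  let K : ℕ → Set (EuclideanSpace ℝ (Fin d)) := fun k =>
    ⋂ x ∈ X, Metric.closedBall x (enclosingRadius X + 1 / ((k : ℝ) + 1))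
  have hcl : ∀ k, IsClosed (K k) := fun k =>
    isClosed_biInter fun x _ => Metric.isClosed_closedBall
  have hKne : (⋂ k, K k).Nonempty := by
    refine IsCompact.nonempty_iInter_of_sequence_nonempty_isCompact_isClosed K ?_ ?_ ?_ hcl
    · intro k y hy
      simp only [K, Set.mem_iInter, Metric.mem_closedBall] at hy ⊢
      intro x hx
      refine (hy x hx).trans ?_
      gcongr
      simp
    · intro k
      obtain ⟨r, ⟨_, C, hC⟩, hr⟩ := exists_lt_of_csInf_lt hne
        (show sInf (enclosingRadii X) < enclosingRadius X + 1 / ((k : ℝ) + 1) from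
          lt_add_of_pos_right _ (by positivity))
      refine ⟨C, ?_⟩
      simp only [K, Set.mem_iInter, Metric.mem_closedBall]
      intro x hx
      rw [dist_comm]
      exact (Metric.mem_closedBall.1 (hC hx)).trans hr.le
    · exact (isCompact_closedBall x₀ _).of_isClosed_subset (hcl 0) (Set.biInter_subset_of_mem hx₀)
  obtain ⟨C, hC⟩ := hKne
  refine ⟨C, fun x hx => ?_⟩
  rw [Metric.mem_closedBall, dist_comm]
  refine le_of_forall_pos_le_add fun ε hε => ?_
  obtain ⟨k, hk⟩ := exists_nat_one_div_lt hε
  have := Set.mem_iInter.1 hC k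
  simp only [K, Set.mem_iInter, Metric.mem_closedBall] at this
  linarith [this x hx]

/-!
The argument works for every compact convex set `K` of dimension at least two whose minimal
enclosing ball has radius `1`; a simplex enters only through its dimension.

Inside the affine hull of `K`, let `U` be the interior of `K` with one point `c` removed, where `c`
is the only point of `K`, if any, from which no point of `K` is farther than `1` (two such points
would give an enclosing ball of radius less than `1` around their midpoint). In dimension at least
two `U` is connected (`Convex.isPreconnected_sdiff_singleton`), and it is dense in `K`. Hence for
every `x ≠ c` in `K` the distance to `x` takes values below and above `1` on `U`, so `x` is at
distance `1` from some point of `U`.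

If `x` and `y` are interior points of `K` at distance `1`, then every point near `x` can be reached
from `x` by four unit steps that alternate between neighbourhoods of `y` and of `x`
(`eventually_reflTransGen_unitStep`), because every small vector has the form `a - a' + b - b'` with
unit vectors close to `y - x` (`exists_four_units`). So the component of a point of `U` contains a
neighbourhood of it, and by connectedness `U` lies in one component. Each `x ≠ c` in `K` is joined
to `U` by a single step. Finally, since no ball of radius less than `1` contains `K`, the point `c`
has a point of `K` at distance exactly `1`, which is joined to `U` in turn
(`Convex.reflTransGen_unitStep`).
-/

section Convex

open Set Metric Filter Topology

/-! ### Unit vectors with prescribed sum -/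

variable {E : Type*} [NormedAddCommGroup E] [InnerProductSpace ℝ E]


theorem exists_norm_eq_one_inner_eq_zero [FiniteDimensional ℝ E]
    (h : 1 < Module.finrank ℝ E) (p : E) : ∃ g : E, ‖g‖ = 1 ∧ inner ℝ p g = 0 := by
  have h1 := Submodule.finrank_add_finrank_orthogonal (ℝ ∙ p)
  have h2 := finrank_span_le_card (R := ℝ) ({p} : Set E)
  simp only [toFinset_singleton, Finset.card_singleton] at h2
  have h3 : 0 < Module.finrank ℝ (ℝ ∙ p)ᗮ := by omega
  have : Nontrivial (ℝ ∙ p)ᗮ := Module.nontrivial_of_finrank_pos h3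
  obtain ⟨g, hg⟩ := exists_norm_eq (ℝ ∙ p)ᗮ (zero_le_one' ℝ)
  exact ⟨g, hg, Submodule.mem_orthogonal_singleton_iff_inner_right.1 g.2⟩

/-- In dimension at least two, a vector `p` of length at most `2` is the sum of two unit vectors,
namely `p / 2 ± t • g` with a unit vector `g` orthogonal to `p`; they are close to `p / 2` when the
length of `p` is close to `2`. -/
theorem exists_unit_add_eq [FiniteDimensional ℝ E] (h : 1 < Module.finrank ℝ E) {p : E}
    (hp : ‖p‖ ≤ 2) : ∃ a b : E, ‖a‖ = 1 ∧ ‖b‖ = 1 ∧ a + b = p ∧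
      ‖a - (1 / 2 : ℝ) • p‖ ^ 2 = 1 - ‖p‖ ^ 2 / 4 ∧
      ‖b - (1 / 2 : ℝ) • p‖ ^ 2 = 1 - ‖p‖ ^ 2 / 4 := by
  obtain ⟨g, hg, hpg⟩ := exists_norm_eq_one_inner_eq_zero h p
  have h0 : 0 ≤ 1 - ‖p‖ ^ 2 / 4 := by nlinarith [norm_nonneg p]
  set t := √(1 - ‖p‖ ^ 2 / 4) with ht
  have ht2 : t ^ 2 = 1 - ‖p‖ ^ 2 / 4 := Real.sq_sqrt h0
  have key : ∀ s : ℝ, s ^ 2 = t ^ 2 → ‖(1 / 2 : ℝ) • p + s • g‖ = 1 := fun s hs => by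
    rw [← sq_eq_sq₀ (norm_nonneg _) zero_le_one, norm_add_sq_real, inner_smul_left,
      inner_smul_right, hpg, norm_smul, norm_smul, hg]
    simp only [mul_zero, Real.norm_eq_abs, mul_one, sq_abs, mul_pow]
    rw [hs, ht2]; ring
  refine ⟨(1 / 2 : ℝ) • p + t • g, (1 / 2 : ℝ) • p + (-t) • g, key t rfl, key (-t) (by ring),
    by module, ?_, ?_⟩ <;>
  simp [norm_smul, hg, ht2]

/-- In dimension at least two, every small vector is an alternating sum of four unit vectors close to
a given unit vector `e`. -/
theorem exists_four_units [FiniteDimensional ℝ E] (h : 1 < Module.finrank ℝ E) {e : E}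
    (he : ‖e‖ = 1) {η : ℝ} (hη : 0 < η) : ∃ δ > 0, ∀ w : E, ‖w‖ ≤ δ →
      ∃ a b a' b' : E, (‖a‖ = 1 ∧ ‖b‖ = 1 ∧ ‖a'‖ = 1 ∧ ‖b'‖ = 1) ∧
        (‖a - e‖ < η ∧ ‖b - e‖ < η ∧ ‖a' - e‖ < η ∧ ‖b' - e‖ < η) ∧
        a - a' + b - b' = w := by
  obtain ⟨c, hc0, hc1, hcη⟩ : ∃ c : ℝ, 0 < c ∧ c ≤ 1 ∧ 3 * c < η :=
    ⟨min 1 (η / 4), by positivity, min_le_left _ _, by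
      linarith [min_le_right 1 (η / 4)]⟩
  -- `w = p - q` with `p = (2 - c ^ 2) • e + w` and `q = (2 - c ^ 2) • e`, both of length at most `2`
  refine ⟨c ^ 2, by positivity, fun w hw => ?_⟩
  have hcc : c ^ 2 ≤ c := by nlinarith
  -- unit vectors with sum `p` are close to `e` when `p` is close to `(2 - c ^ 2) • e`
  have near : ∀ v : E, ‖v‖ ≤ c ^ 2 → ∃ a b : E, ‖a‖ = 1 ∧ ‖b‖ = 1 ∧
      a + b = (2 - c ^ 2) • e + v ∧ ‖a - e‖ < η ∧ ‖b - e‖ < η := fun v hv => by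
    set p := (2 - c ^ 2) • e + v with hp
    have hn : ‖(2 - c ^ 2) • e‖ = 2 - c ^ 2 := by
      rw [norm_smul, he, mul_one, Real.norm_of_nonneg (by linarith)]
    have hp2 : ‖p‖ ≤ 2 := (norm_add_le _ _).trans (by linarith)
    have hp1 : 2 - 2 * c ^ 2 ≤ ‖p‖ := by
      have := norm_sub_le p v
      rw [hp, add_sub_cancel_right, hn, ← hp] at this
      linarith
    obtain ⟨a, b, ha, hb, hab, ha', hb'⟩ := exists_unit_add_eq h hp2
    have hpe : ‖(1 / 2 : ℝ) • p - e‖ ≤ c := by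
      have : (1 / 2 : ℝ) • p - e = (1 / 2 : ℝ) • v - (c ^ 2 / 2) • e := by rw [hp]; module
      rw [this]
      refine (norm_sub_le _ _).trans ?_
      rw [norm_smul, norm_smul, he, Real.norm_of_nonneg (by positivity),
        Real.norm_of_nonneg (by positivity)]
      linarith
    have hsq : 1 - ‖p‖ ^ 2 / 4 ≤ (2 * c) ^ 2 := by nlinarith
    have fin : ∀ x : E, ‖x - (1 / 2 : ℝ) • p‖ ^ 2 = 1 - ‖p‖ ^ 2 / 4 → ‖x - e‖ < η := fun x hx => by
      have h1 : ‖x - (1 / 2 : ℝ) • p‖ ≤ 2 * c := abs_le_of_sq_le_sq' (hx ▸ hsq) (by linarith) |>.2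
      linarith [norm_sub_le_norm_sub_add_norm_sub x ((1 / 2 : ℝ) • p) e]
    exact ⟨a, b, ha, hb, hab, fin a ha', fin b hb'⟩
  obtain ⟨a, b, ha, hb, hab, hae, hbe⟩ := near w hw
  obtain ⟨a', b', ha', hb', hab', hae', hbe'⟩ := near 0 (by simpa using sq_nonneg c)
  refine ⟨a, b, a', b', ⟨ha, hb, ha', hb'⟩, ⟨hae, hbe, hae', hbe'⟩, ?_⟩
  rw [show a - a' + b - b' = (a + b) - (a' + b') by abel, hab, hab']
  module

/-! ### Punctured convex open sets -/

theorem Convex.isPreconnected_sdiff_singleton [FiniteDimensional ℝ E]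
    (h : 1 < Module.finrank ℝ E) {A : Set E} (hA : Convex ℝ A) (ho : IsOpen A) (c : E) :
    IsPreconnected (A \ {c}) := by
  rcases (A \ {c}).eq_empty_or_nonempty with he | hne
  · rw [he]; exact isPreconnected_empty
  refine (isPathConnected_iff.2 ⟨hne, fun a ha b hb => ?_⟩).isConnected.isPreconnected
  have join : ∀ x ∈ A, ∀ y ∈ A, c ∉ segment ℝ x y → JoinedIn (A \ {c}) x y :=
    fun x hx y hy hc => JoinedIn.of_segment_subset fun z hz =>
      ⟨hA.segment_subset hx hy hz, fun hzc => hc (hzc ▸ hz)⟩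
  by_cases hc : c ∈ segment ℝ a b
  · have hcA := hA.segment_subset ha.1 hb.1 hc
    obtain ⟨g, hg, hpg⟩ := exists_norm_eq_one_inner_eq_zero h (b - a)
    obtain ⟨ε, hε, hball⟩ := Metric.isOpen_iff.1 ho c hcA
    -- detour through a point of `A` just beside `c`
    set z := c + (ε / 2) • g with hz
    have hzA : z ∈ A := hball (by
      rw [mem_ball, hz, dist_self_add_left, norm_smul, hg, Real.norm_of_nonneg (by positivity)]
      linarith)
    rw [segment_eq_image'] at hc
    obtain ⟨s, -, hs⟩ := hc
    have avoid : ∀ x, x ≠ c → inner ℝ (c - x) g = 0 → c ∉ segment ℝ x z := fun x hxc hx hcx => by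
      rw [segment_eq_image'] at hcx
      obtain ⟨t, -, ht⟩ := hcx
      have h1 : c - x = t • ((c - x) + (ε / 2) • g) := by
        simp only at ht
        have h0 : c - x = t • (z - x) := by rw [sub_eq_iff_eq_add', ht]
        rw [show (c - x) + (ε / 2) • g = z - x by rw [hz]; abel]
        exact h0
      have h2 : inner ℝ (c - x) g = t * (ε / 2) := by
        rw [h1, inner_smul_left, inner_add_left, hx, inner_smul_left, real_inner_self_eq_norm_sq, hg]
        simp
      have h3 : t = 0 := by
        rw [hx] at h2
        rcases mul_eq_zero.1 h2.symm with h | h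
        · exact h
        · linarith
      rw [h3, zero_smul, sub_eq_zero] at h1
      exact hxc h1.symm
    have hac : inner ℝ (c - a) g = 0 := by
      rw [← hs]
      simp [inner_smul_left, hpg]
    have hbc : inner ℝ (c - b) g = 0 := by
      rw [show c - b = (c - a) - (b - a) by abel, inner_sub_left, hac, hpg, sub_zero]
    exact (join a ha.1 z hzA (avoid a ha.2 hac)).trans
      (join b hb.1 z hzA (avoid b hb.2 hbc)).symm
  · exact join a ha.1 b hb.1 hc

/-! ### Unit steps in a convex set -/

/-- A step of length `1` between two points of `K`. -/
def UnitStep {α : Type*} [PseudoMetricSpace α] (K : Set α) (x y : α) : Prop :=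
  x ∈ K ∧ y ∈ K ∧ dist x y = 1

theorem UnitStep.symm {α : Type*} [PseudoMetricSpace α] {K : Set α} {x y : α}
    (h : UnitStep K x y) : UnitStep K y x :=
  ⟨h.2.1, h.1, dist_comm x y ▸ h.2.2⟩

theorem eventually_reflTransGen_unitStep [FiniteDimensional ℝ E] (h : 1 < Module.finrank ℝ E)
    {K : Set E} {x y : E} (hx : x ∈ interior K) (hy : y ∈ interior K) (hxy : dist x y = 1) :
    ∀ᶠ z in 𝓝 x, Relation.ReflTransGen (UnitStep K) x z := by
  obtain ⟨ε₁, hε₁, h₁⟩ := Metric.mem_nhds_iff.1 (mem_interior_iff_mem_nhds.1 hx)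
  obtain ⟨ε₂, hε₂, h₂⟩ := Metric.mem_nhds_iff.1 (mem_interior_iff_mem_nhds.1 hy)
  obtain ⟨η, hη, hη₁, hη₂⟩ : ∃ η : ℝ, 0 < η ∧ 4 * η ≤ ε₁ ∧ 4 * η ≤ ε₂ :=
    ⟨min ε₁ ε₂ / 4, by positivity, by linarith [min_le_left ε₁ ε₂], by
      linarith [min_le_right ε₁ ε₂]⟩
  have he : ‖y - x‖ = 1 := by rw [← dist_eq_norm, dist_comm, hxy]
  obtain ⟨δ, hδ, H⟩ := exists_four_units h he hη
  filter_upwards [Metric.closedBall_mem_nhds x hδ] with z hz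
  obtain ⟨a, b, a', b', ⟨ha, hb, ha', hb'⟩, ⟨hae, hbe, hae', hbe'⟩, hw⟩ :=
    H (z - x) (by rwa [← dist_eq_norm])
  have hz' : z = x + a - a' + b - b' := by
    rw [← sub_add_cancel z x, ← hw]; abel
  have k0 : x ∈ K := interior_subset hx
  have k1 : x + a ∈ K := h₂ (by
    rw [mem_ball, dist_eq_norm, show x + a - y = a - (y - x) by abel]
    linarith)
  have k2 : x + a - a' ∈ K := h₁ (by
    rw [mem_ball, dist_eq_norm, show x + a - a' - x = (a - (y - x)) - (a' - (y - x)) by abel]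
    linarith [norm_sub_le (a - (y - x)) (a' - (y - x))])
  have k3 : x + a - a' + b ∈ K := h₂ (by
    rw [mem_ball, dist_eq_norm, show x + a - a' + b - y =
      ((a - (y - x)) - (a' - (y - x))) + (b - (y - x)) by abel]
    linarith [norm_sub_le (a - (y - x)) (a' - (y - x)),
      norm_add_le ((a - (y - x)) - (a' - (y - x))) (b - (y - x))])
  have k4 : x + a - a' + b - b' ∈ K := h₁ (by
    rw [mem_ball, dist_eq_norm, show x + a - a' + b - b' - x =
      ((a - (y - x)) - (a' - (y - x))) + ((b - (y - x)) - (b' - (y - x))) by abel]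
    linarith [norm_sub_le (a - (y - x)) (a' - (y - x)), norm_sub_le (b - (y - x)) (b' - (y - x)),
      norm_add_le ((a - (y - x)) - (a' - (y - x))) ((b - (y - x)) - (b' - (y - x)))])
  rw [hz']
  exact .head (b := x + a) ⟨k0, k1, by simpa [dist_eq_norm] using ha⟩ <|
    .head (b := x + a - a') ⟨k1, k2, by simpa [dist_eq_norm] using ha'⟩ <|
    .head (b := x + a - a' + b) ⟨k2, k3, by simpa [dist_eq_norm] using hb⟩ <|
    .single ⟨k3, k4, by simpa [dist_eq_norm] using hb'⟩

/-- The hypotheses `hfar` and `hcen` say that no ball of radius less than `1` around a point of `K`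
contains `K`, and that at most one ball of radius `1` around a point of `K` does. -/
theorem Convex.reflTransGen_unitStep [FiniteDimensional ℝ E] (h : 1 < Module.finrank ℝ E)
    {K : Set E} (hK : Convex ℝ K) (hi : (interior K).Nonempty)
    (hfar : ∀ x ∈ K, ∃ y ∈ K, 1 ≤ dist x y)
    (hcen : {x ∈ K | ∀ y ∈ K, dist x y ≤ 1}.Subsingleton) {x y : E} (hx : x ∈ K) (hy : y ∈ K) :
    Relation.ReflTransGen (UnitStep K) x y := by
  obtain ⟨c, hc⟩ : ∃ c, ∀ x ∈ K, x ≠ c → ∃ y ∈ K, 1 < dist x y := by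
    by_cases hex : ∃ c ∈ K, ∀ y ∈ K, dist c y ≤ 1
    · obtain ⟨c, hcK, hc⟩ := hex
      refine ⟨c, fun x hxK hxc => ?_⟩
      by_contra! hcon
      exact hxc (hcen ⟨hxK, hcon⟩ ⟨hcK, hc⟩)
    · push Not at hex
      exact ⟨0, fun x hxK _ => hex x hxK⟩
  set U := interior K \ {c}
  have hUK : U ⊆ K := sdiff_subset.trans interior_subset
  have hUpre : IsPreconnected U := hK.interior.isPreconnected_sdiff_singleton h isOpen_interior c
  have : Nontrivial E := Module.nontrivial_of_finrank_pos (R := ℝ) (by omega)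
  have hne : (𝓝[≠] c).NeBot := Module.punctured_nhds_neBot ℝ E c
  have hdense : K ⊆ closure U := by
    have h1 : interior K ⊆ closure U := (dense_compl_singleton c).open_subset_closure_inter
      isOpen_interior
    calc K ⊆ closure K := subset_closure
      _ = closure (interior K) := (hK.closure_interior_eq_closure_of_nonempty_interior hi).symm
      _ ⊆ closure U := closure_minimal h1 isClosed_closure
  have step : ∀ x ∈ K, (∃ y ∈ K, 1 < dist x y) → ∃ z ∈ U, UnitStep K x z := by
    rintro x hxK ⟨y, hyK, hxy⟩
    obtain ⟨u, hu, huU⟩ := mem_closure_iff.1 (hdense hxK) (ball x 1) isOpen_ball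
      (mem_ball_self one_pos)
    obtain ⟨v, hv, hvU⟩ := mem_closure_iff.1 (hdense hyK) {v | 1 < dist x v}
      (isOpen_lt continuous_const (by fun_prop)) hxy
    rw [mem_ball, dist_comm] at hu
    obtain ⟨z, hzU, hz⟩ := hUpre.intermediate_value huU hvU (f := fun z => dist x z)
      (by fun_prop) ⟨hu.le, le_of_lt hv⟩
    exact ⟨z, hzU, hxK, hUK hzU, hz⟩
  have hsymm : Std.Symm (UnitStep K) := ⟨fun _ _ h => h.symm⟩
  have hUU : ∀ u ∈ U, ∀ v ∈ U, Relation.ReflTransGen (UnitStep K) u v := fun u hu v hv => by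
    refine hUpre.induction₂ (Relation.ReflTransGen (UnitStep K)) (fun x hx => ?_)
      (fun _ _ _ _ _ _ => .trans) (fun _ _ _ _ hr => Std.Symm.symm _ _ hr) hu hv
    obtain ⟨z, hzU, hz⟩ := step x (hUK hx) (hc x (hUK hx) hx.2)
    exact nhdsWithin_le_nhds (eventually_reflTransGen_unitStep h hx.1 hzU.1 hz.2.2)
  have toU : ∀ x ∈ K, ∃ u ∈ U, Relation.ReflTransGen (UnitStep K) x u := fun x hxK => by
    by_cases hx : ∃ y ∈ K, 1 < dist x y
    · obtain ⟨z, hzU, hz⟩ := step x hxK hx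
      exact ⟨z, hzU, .single hz⟩
    · -- here `x = c`, and a point at distance `1` from `c` is not `c`
      push Not at hx
      obtain ⟨y, hyK, hxy⟩ := hfar x hxK
      have hxy1 : dist x y = 1 := le_antisymm (hx y hyK) hxy
      have hxc : x = c := by
        by_contra hne
        obtain ⟨w, hwK, hw⟩ := hc x hxK hne
        exact (hx w hwK).not_gt hw
      have hyc : y ≠ c := fun hyc => by simp [hxc, hyc] at hxy1
      obtain ⟨z, hzU, hz⟩ := step y hyK (hc y hyK hyc)
      exact ⟨z, hzU, .head ⟨hxK, hyK, hxy1⟩ (.single hz)⟩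
  obtain ⟨u, huU, hxu⟩ := toU x hx
  obtain ⟨v, hvU, hyv⟩ := toU y hy
  exact (hxu.trans (hUU u huU v hvU)).trans (Std.Symm.symm _ _ hyv)

end Convex

/-! ### The minimal enclosing ball -/

theorem enclosingRadius_le {d : ℕ} {X : Set (EuclideanSpace ℝ (Fin d))}
    {C : EuclideanSpace ℝ (Fin d)} {r : ℝ} (hr : 0 ≤ r) (h : X ⊆ Metric.closedBall C r) :
    enclosingRadius X ≤ r :=
  csInf_le ⟨0, fun _ h => h.1⟩ ⟨hr, C, h⟩

theorem exists_enclosingRadius_le_dist {d : ℕ} {X : Set (EuclideanSpace ℝ (Fin d))}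
    (hX : IsCompact X) (hne : X.Nonempty) (x : EuclideanSpace ℝ (Fin d)) :
    ∃ y ∈ X, enclosingRadius X ≤ dist x y := by
  obtain ⟨y, hy, hmax⟩ := hX.exists_isMaxOn hne (f := fun y => dist x y) (by fun_prop)
  refine ⟨y, hy, enclosingRadius_le (C := x) dist_nonneg fun z hz => ?_⟩
  rw [Metric.mem_closedBall, dist_comm]
  exact hmax hz

/-- The minimal enclosing ball is unique: the intersection of two of them would lie in a smaller ball
around the midpoint of their centres, by the parallelogram law. -/
theorem subsingleton_setOf_dist_le_enclosingRadius {d : ℕ}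
    {X : Set (EuclideanSpace ℝ (Fin d))} (hne : X.Nonempty) :
    {x | ∀ y ∈ X, dist x y ≤ enclosingRadius X}.Subsingleton := by
  intro x hx x' hx'
  by_contra hxx
  have hd : 0 < dist x x' := dist_pos.2 hxx
  set R := enclosingRadius X
  have key : ∀ y ∈ X, dist y (midpoint ℝ x x') ^ 2 ≤ R ^ 2 - (dist x x' / 2) ^ 2 := fun y hy => by
    have h1 := EuclideanGeometry.dist_sq_add_dist_sq_eq_two_mul_dist_midpoint_sq_add_half_dist_sq
      y x x'
    have h2 : dist y x ^ 2 ≤ R ^ 2 := by gcongr; rw [dist_comm]; exact hx y hy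
    have h3 : dist y x' ^ 2 ≤ R ^ 2 := by gcongr; rw [dist_comm]; exact hx' y hy
    linarith
  obtain ⟨y₀, hy₀⟩ := hne
  have hR : 0 ≤ R := dist_nonneg.trans (hx y₀ hy₀)
  have hle : R ≤ √(R ^ 2 - (dist x x' / 2) ^ 2) :=
    enclosingRadius_le (Real.sqrt_nonneg _) fun y hy => Real.le_sqrt_of_sq_le (key y hy)
  have h0 := (sq_nonneg _).trans (key y₀ hy₀)
  have := (Real.le_sqrt hR h0).1 hle
  nlinarith

/-! ### Simplices -/

theorem mainTheorem2 (d n : ℕ) (hn : 2 ≤ n)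
    (S : Affine.Simplex ℝ (EuclideanSpace ℝ (Fin d)) n)
    (hr : enclosingRadius (convexHull ℝ (Set.range S.points)) = 1) :
    ((unitDistanceGraph d).induce (convexHull ℝ (Set.range S.points))).Connected := by
  set X := convexHull ℝ (Set.range S.points)
  have hXc : IsCompact X := (Set.finite_range S.points).isCompact_convexHull ℝ
  have hXne : X.Nonempty := convexHull_nonempty_iff.2 (Set.range_nonempty S.points)
  -- identify the affine hull of the simplex with its direction `V`
  set V := vectorSpan ℝ (Set.range S.points)
  have hrank : Module.finrank ℝ V = n := S.independent.finrank_vectorSpan (Fintype.card_fin _)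
  let φ : V →ᵃ[ℝ] EuclideanSpace ℝ (Fin d) :=
    V.subtype.toAffineMap + AffineMap.const ℝ V (S.points 0)
  have hφ : ∀ v, φ v = (v : EuclideanSpace ℝ (Fin d)) + S.points 0 := fun _ => rfl
  have hdist : ∀ u v, dist (φ u) (φ v) = dist u v := fun u v => by
    rw [hφ, hφ, dist_add_right]; rfl
  let q : Fin (n + 1) → V := fun i =>
    ⟨S.points i -ᵥ S.points 0, vsub_mem_vectorSpan ℝ ⟨i, rfl⟩ ⟨0, rfl⟩⟩
  have hq : φ ∘ q = S.points := by
    ext1 i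
    simp [hφ, q]
  have hqi : AffineIndependent ℝ q := AffineIndependent.of_comp φ (hq ▸ S.independent)
  set K := convexHull ℝ (Set.range q) with hK
  have himg : φ '' K = X := by
    rw [hK, AffineMap.image_convexHull, ← Set.range_comp, hq]
  have hmem : ∀ v ∈ K, φ v ∈ X := fun v hv => himg ▸ Set.mem_image_of_mem φ hv
  have hint : (interior K).Nonempty := by
    rw [hK, interior_convexHull_nonempty_iff_affineSpan_eq_top,
      hqi.affineSpan_eq_top_iff_card_eq_finrank_add_one, hrank, Fintype.card_fin]
  have hfar : ∀ u ∈ K, ∃ v ∈ K, 1 ≤ dist u v := fun u _ => by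
    obtain ⟨y, hy, hle⟩ := exists_enclosingRadius_le_dist hXc hXne (φ u)
    rw [← himg] at hy
    obtain ⟨v, hv, rfl⟩ := hy
    exact ⟨v, hv, by rwa [hr, hdist] at hle⟩
  have hcen : {u ∈ K | ∀ v ∈ K, dist u v ≤ 1}.Subsingleton := by
    have aux : ∀ u ∈ {u ∈ K | ∀ v ∈ K, dist u v ≤ 1},
        φ u ∈ {x | ∀ y ∈ X, dist x y ≤ enclosingRadius X} := by
      rintro u ⟨-, hu⟩ y hy
      rw [← himg] at hy
      obtain ⟨v, hv, rfl⟩ := hy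
      rw [hr, hdist]
      exact hu v hv
    intro u hu u' hu'
    have := subsingleton_setOf_dist_le_enclosingRadius hXne (aux u hu) (aux u' hu')
    rwa [← dist_eq_zero, hdist, dist_eq_zero] at this
  have hne : Nonempty X := hXne.to_subtype
  refine { preconnected := ?_ }
  rintro ⟨x, hx⟩ ⟨y, hy⟩
  obtain ⟨u, hu, rfl⟩ := himg.symm ▸ hx
  obtain ⟨v, hv, rfl⟩ := himg.symm ▸ hy
  have hpath := (convex_convexHull ℝ (Set.range q)).reflTransGen_unitStep (by omega) hint hfar hcen
    hu hv
  have hreach : ∀ w, Relation.ReflTransGen (UnitStep K) u w → ∀ hw : φ w ∈ X,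
      ((unitDistanceGraph d).induce X).Reachable ⟨φ u, hx⟩ ⟨φ w, hw⟩ := by
    intro w hw
    induction hw with
    | refl => exact fun _ => .rfl
    | @tail b c _ hbc ih =>
      intro hc
      refine (ih (hmem b hbc.1)).trans (SimpleGraph.Adj.reachable ?_)
      change dist (φ b) (φ c) = 1
      rw [hdist, hbc.2.2]
  exact hreach v hpath hy
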